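/- **Definitions.** Let $\alpha,\beta$ be reals. Write $\mathrm{LC}(\beta)=\{q\in\mathbb{Q}: 0\le q<\beta\}$. A *$\mathbb{Q}$-translation function* from $\beta$ to $\alpha$ is a partial computable function $g$ from $\mathbb{Q}\cap[0,1)$ to itself such that for every $q\in\mathrm{LC}(\beta)$ the value $g(q)$ is defined and satisfies $g(q)<\alpha$, and $g(q)\to\alpha$ as $q\to\beta$ with $q\in\mathrm{LC}(\beta)$ (an empty condition if $\mathrm{LC}(\beta)=\emptyset$). We say that $\alpha$ is *Solovay reducible* to $\beta$, written $\alpha\le_{\mathrm S}\beta$, if there are a real constant $c$ and a $\mathbb{Q}$-translation function $g$ from $\beta$ to $\alpha$ with $\alpha-g(q)<c(\beta-q)$ for all $q\in\mathrm{LC}(\beta)$; it is *total Solovay reducible* to $\beta$, written $\alpha\le_{\mathrm S}^{\mathrm{tot}}\beta$, if moreover such a $g$ can be chosen that is defined on all of $\mathbb{Q}\cap[0,1)$. An *effective approximation* of a real $x$ is a sequence $(q_n)_{n\ge 0}$ of rationals with $|q_n-q_{n+1}|<2^{-n}$ for all $n$ and $\lim_n q_n=x$. A real is *computable* if it has a computable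 effective approximation. A real function $f$ is *computable on* a set $X\subseteq\mathrm{dom}(f)$ if there is a single oracle machine that, for every $x\in X$ and every effective approximation of $x$ given as oracle, returns an effective approximation of $f(x)$. A *weakly $\mathbb{R}$-translation function* from $\beta$ to $\alpha$ is a real function $f$ that is computable on $[0,\beta)$ and satisfies $f(x)\to\alpha$ as $x\to\beta$ with $x\in[0,\beta)$; it is an *$\mathbb{R}$-translation function* if moreover it maps $[0,\beta)$ to $[0,\alpha)$. Now $\alpha$ is * *computably Lipschitz reducible to $\beta$ on a c.e. open interval*, written $\alpha\le_{\mathrm{cL}}^{\mathrm{open}}\beta$, if there is a weakly $\mathbb{R}$-translation function from $\beta$ to $\alpha$ that is Lipschitz continuous on $[0,\beta)$; * *real Solovay reducible to $\beta$*, written $\alpha\le_{\mathrm S}^{\mathbb{R}}\beta$, if there is an $\mathbb{R}$-translation function from $\beta$ to $\alpha$ that is Lipschitz continuous on $[0,\beta)$; * *computably Lipschitz reducible to $\beta$ locally*, written $\alpha\le_{\mathrm{cL}}^{\mathrm{loc}}\beta$, if there are a real $b>\beta$ and a real function $f$ that is Lipschitz continuous and computable on $[0,b]$ with $f(\beta)=\alpha$.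 **Theorem.** For all reals $\alpha$ and $\beta$: 1. $\alpha\le_{\mathrm S}\beta$ implies $\alpha\le_{\mathrm{cL}}^{\mathrm{open}}\beta$; 2. if $\beta>0$, then $\alpha\le_{\mathrm S}^{\mathrm{tot}}\beta$ implies $\alpha\le_{\mathrm{cL}}^{\mathrm{loc}}\beta$; 3. if $\alpha$ is not computable, then $\alpha\le_{\mathrm S}\beta$ implies $\alpha\le_{\mathrm S}^{\mathbb{R}}\beta$. -/

import Mathlib

open Filter Topology
open scoped NNReal

namespace SolovayVariants

/-! ### Rationals as inputs and outputs of computations -/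

/-- The code of a rational: the pair of its reduced numerator and denominator. -/
def ratCode (q : ℚ) : ℕ := Nat.pair (Encodable.encode q.num) q.den

/-- A partial function on the rationals is partial computable if some partial recursive function
computes it on codes: it halts on the code of `q` exactly if `g q` is defined, and then returns the
code of `g q`. -/
def PartialComputable (g : ℚ →. ℚ) : Prop :=
  ∃ φ : ℕ →. ℕ, Nat.Partrec φ ∧ ∀ q : ℚ, φ (ratCode q) = (g q).map ratCode

/-- A sequence of rationals is computable if the sequence of the codes is. -/
def ComputableSeq (q : ℕ → ℚ) : Prop :=
  Computable fun n => ratCode (q n)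

/-! ### Solovay reducibility via functions on the rationals -/

/-- The left cut of `β`: the rationals `q` with `0 ≤ q < β`. -/
def leftCut (β : ℝ) : Set ℚ := {q | 0 ≤ q ∧ (q : ℝ) < β}

/-- `g` is a `ℚ`-translation function from `β` to `α`: a partial computable function from
`ℚ ∩ [0,1)` to itself, defined and below `α` on the left cut of `β`, with left limit `α` at `β`. -/
structure IsQTranslation (g : ℚ →. ℚ) (β α : ℝ) : Prop where
  partialComputable : PartialComputable g
  mem_unit : ∀ q r : ℚ, r ∈ g q → q ∈ Set.Ico (0 : ℚ) 1 ∧ r ∈ Set.Ico (0 : ℚ) 1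
  dom_of_mem_leftCut : ∀ q ∈ leftCut β, (g q).Dom
  lt_of_mem_leftCut : ∀ q ∈ leftCut β, ∀ r ∈ g q, (r : ℝ) < α
  left_limit : ∀ ε : ℝ, 0 < ε → ∃ δ : ℝ, 0 < δ ∧
    ∀ q ∈ leftCut β, β - δ < (q : ℝ) → ∀ r ∈ g q, |(r : ℝ) - α| < ε

/-- `α` is Solovay reducible to `β` via `g`. -/
def SolovayReducibleVia (g : ℚ →. ℚ) (α β : ℝ) : Prop :=
  IsQTranslation g β α ∧
    ∃ c : ℝ, ∀ q ∈ leftCut β, ∀ r ∈ g q, α - (r : ℝ) < c * (β - (q : ℝ))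

/-- Solovay reducibility. -/
def SolovayReducible (α β : ℝ) : Prop :=
  ∃ g : ℚ →. ℚ, SolovayReducibleVia g α β

/-- Total Solovay reducibility: the translation function is defined on all of `ℚ ∩ [0,1)`. -/
def TotalSolovayReducible (α β : ℝ) : Prop :=
  ∃ g : ℚ →. ℚ, SolovayReducibleVia g α β ∧ ∀ q ∈ Set.Ico (0 : ℚ) 1, (g q).Dom

/-! ### Oracle machines and computable real functions -/

/-- Programs of oracle machines: the programs for partial recursive functions, together with an
instruction that queries the oracle. -/
inductive OracleMachine : Type
  | zero : OracleMachine
  | succ : OracleMachine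
  | left : OracleMachine
  | right : OracleMachine
  | oracle : OracleMachine
  | pair : OracleMachine → OracleMachine → OracleMachine
  | comp : OracleMachine → OracleMachine → OracleMachine
  | prec : OracleMachine → OracleMachine → OracleMachine
  | rfind : OracleMachine → OracleMachine

/-- The partial function computed by an oracle machine with the oracle `O`. -/
def OracleMachine.eval (O : ℕ → ℕ) : OracleMachine → ℕ →. ℕ
  | .zero => fun _ => Part.some 0
  | .succ => fun n => Part.some (n + 1)
  | .left => fun n => Part.some n.unpair.1
  | .right => fun n => Part.some n.unpair.2
  | .oracle => fun n => Part.some (O n)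
  | .pair M N => fun n => (M.eval O n).bind fun a => (N.eval O n).map fun b => Nat.pair a b
  | .comp M N => fun n => (N.eval O n).bind (M.eval O)
  | .prec M N => fun k =>
      Nat.rec (M.eval O k.unpair.1)
        (fun y IH => IH.bind fun i => N.eval O (Nat.pair k.unpair.1 (Nat.pair y i))) k.unpair.2
  | .rfind M => fun a => Nat.rfind fun n => (M.eval O (Nat.pair a n)).map fun m => decide (m = 0)

/-- `M`, used as a Type 2 machine, returns the infinite sequence `q` from the input sequence `p`. -/
def OracleMachine.Returns (M : OracleMachine) (p q : ℕ → ℚ) : Prop :=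
  ∀ n : ℕ, ratCode (q n) ∈ M.eval (fun k => ratCode (p k)) n

/-- `q` is an effective approximation of the real `x`. -/
def IsEffectiveApprox (q : ℕ → ℚ) (x : ℝ) : Prop :=
  (∀ n : ℕ, |q n - q (n + 1)| < (1 / 2 : ℚ) ^ n) ∧ Tendsto (fun n => (q n : ℝ)) atTop (𝓝 x)

/-- A real is computable if it has a computable effective approximation. -/
def ComputableReal (x : ℝ) : Prop :=
  ∃ q : ℕ → ℚ, ComputableSeq q ∧ IsEffectiveApprox q x

/-- The real function `f` is computable on `X`: one machine turns every effective approximation of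
every `x ∈ X` into an effective approximation of `f x`. -/
def ComputableOn (f : ℝ → ℝ) (X : Set ℝ) : Prop :=
  ∃ M : OracleMachine, ∀ x ∈ X, ∀ p : ℕ → ℚ, IsEffectiveApprox p x →
    ∃ q : ℕ → ℚ, M.Returns p q ∧ IsEffectiveApprox q (f x)

/-! ### Reducibilities via functions on the reals -/

/-- `f` is a weakly `ℝ`-translation function from `β` to `α`. Only the values of `f` on `[0,β)`
matter. -/
structure IsWeakRTranslation (f : ℝ → ℝ) (β α : ℝ) : Prop where
  computableOn : ComputableOn f (Set.Ico 0 β)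
  left_limit : Tendsto f (𝓝[Set.Ico 0 β] β) (𝓝 α)

/-- `f` is an `ℝ`-translation function from `β` to `α`: in addition it maps `[0,β)` to `[0,α)`. -/
structure IsRTranslation (f : ℝ → ℝ) (β α : ℝ) : Prop extends IsWeakRTranslation f β α where
  mapsTo : Set.MapsTo f (Set.Ico 0 β) (Set.Ico 0 α)

/-- Real Solovay reducibility of `α` to `β`. -/
def RealSolovayReducible (α β : ℝ) : Prop :=
  ∃ f : ℝ → ℝ, IsRTranslation f β α ∧ ∃ K : ℝ≥0, LipschitzOnWith K f (Set.Ico 0 β)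

/-- Computable Lipschitz reducibility of `α` to `β` on a c.e. open interval. -/
def CLOpenReducible (α β : ℝ) : Prop :=
  ∃ f : ℝ → ℝ, IsWeakRTranslation f β α ∧ ∃ K : ℝ≥0, LipschitzOnWith K f (Set.Ico 0 β)

/-- Local computable Lipschitz reducibility of `α` to `β`. -/
def CLLocalReducible (α β : ℝ) : Prop :=
  ∃ b : ℝ, β < b ∧ ∃ f : ℝ → ℝ, ComputableOn f (Set.Icc 0 b) ∧
    (∃ K : ℝ≥0, LipschitzOnWith K f (Set.Icc 0 b)) ∧ f β = α

end SolovayVariants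

/-!
Let `g` be a translation function from `β` to `α` with constant `c`. At level `n`, sample `g` at
the midpoints of the dyadic intervals of length `2⁻ⁿ`, round, and turn the samples into a monotone
sequence of slope at most `c`. Its values at grid points left of `β` lie between
`α - c * (β - x) - O(2⁻ⁿ)` and `α`, but successive levels need not be close to each other. So level
`n + 1` is forced into a band of width `O(2⁻ⁿ)` above the interpolation of level `n`. This keeps
both bounds, and the levels now converge at a computable rate to a monotone `c`-Lipschitz function
`f` with `α - c * (β - x) ≤ f x ≤ α` for `0 ≤ x < β`, whence `f x → α` as `x → β`.

All values of `f` at `x` depend only on samples at rationals to the left of `x`; hence `f` is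
computable on `[0,β)` even if `g` is partial, and also beyond `β` if `g` is total. If `f x = α` for
some `x < β`, then by monotonicity `f r = α` for a rational `r`, and `α` is computable.
-/

namespace SolovayVariants

/-! ### Monotone sequences of bounded slope -/

/-- Monotone sequences of natural numbers whose increments are at most `c`: the discrete form of
monotone `c`-Lipschitz functions. -/
structure SlopeLE (c : ℕ) (a : ℕ → ℕ) : Prop where
  le_succ : ∀ j, a j ≤ a (j + 1)
  succ_le : ∀ j, a (j + 1) ≤ a j + c

namespace SlopeLE

variable {c : ℕ} {a b : ℕ → ℕ}

protected lemma monotone (ha : SlopeLE c a) : Monotone a := monotone_nat_of_le_succ ha.le_succ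

lemma add_le (ha : SlopeLE c a) (j k : ℕ) : a (j + k) ≤ a j + c * k := by
  induction k with
  | zero => rfl
  | succ k ih => calc
      a (j + k + 1) ≤ a (j + k) + c := ha.succ_le _
      _ ≤ a j + c * k + c := by gcongr
      _ = a j + c * (k + 1) := by ring

protected lemma sup (ha : SlopeLE c a) (hb : SlopeLE c b) : SlopeLE c (a ⊔ b) where
  le_succ j := sup_le_sup (ha.le_succ j) (hb.le_succ j)
  succ_le j := by
    have := ha.succ_le j
    have := hb.succ_le j
    simp only [Pi.sup_apply]
    omega

protected lemma inf (ha : SlopeLE c a) (hb : SlopeLE c b) : SlopeLE c (a ⊓ b) where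
  le_succ j := inf_le_inf (ha.le_succ j) (hb.le_succ j)
  succ_le j := by
    have := ha.succ_le j
    have := hb.succ_le j
    simp only [Pi.inf_apply]
    omega

lemma add_const (ha : SlopeLE c a) (K : ℕ) : SlopeLE c fun j => a j + K where
  le_succ j := Nat.add_le_add_right (ha.le_succ j) K
  succ_le j := by
    have := ha.succ_le j
    omega

lemma floor_le (ha : SlopeLE c a) {s t : ℝ} (hst : s ≤ t) :
    (a ⌊t⌋₊ : ℝ) ≤ a ⌊s⌋₊ + c * (t - s + 1) := by
  obtain ⟨k, hk⟩ := Nat.exists_eq_add_of_le (Nat.floor_mono hst)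
  have hk' : (k : ℝ) ≤ t - s + 1 := by
    rcases le_total 0 t with ht | ht
    · have h₁ := Nat.floor_le ht
      have h₂ := Nat.lt_floor_add_one s
      rw [hk] at h₁
      push_cast at h₁
      linarith
    · have : k = 0 := by
        rw [Nat.floor_of_nonpos ht] at hk
        omega
      rw [this, Nat.cast_zero]
      linarith
  calc (a ⌊t⌋₊ : ℝ) ≤ a ⌊s⌋₊ + c * k := by rw [hk]; exact_mod_cast ha.add_le _ k
    _ ≤ a ⌊s⌋₊ + c * (t - s + 1) := by gcongr

end SlopeLE

/-- A monotone sequence of slope at most `c` that starts at `0` and rises towards the values of `v`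
where these are larger. The value `v j` belongs to the interval between the grid points `j` and
`j + 1`, hence it is first felt at `j + 1`. -/
def regularize (c : ℕ) (v : ℕ → ℕ) : ℕ → ℕ
  | 0 => 0
  | j + 1 => max (regularize c v j) (min (v j) (regularize c v j + c))

/-- Passage from the grid of mesh `2⁻ⁿ` to the grid of mesh `2⁻ⁿ⁻¹`, for values measured in units
of the mesh: linear interpolation, delayed by one point of the fine grid so that the value at a
point depends only on values at points to its left. -/
def halveMesh (a : ℕ → ℕ) (j : ℕ) : ℕ := a (j / 2) + a ((j - 1) / 2)

section Sequences

variable {c : ℕ}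

lemma slopeLE_regularize (c : ℕ) (v : ℕ → ℕ) : SlopeLE c (regularize c v) where
  le_succ _ := le_max_left _ _
  succ_le _ := max_le (Nat.le_add_right _ _) (min_le_right _ _)

lemma regularize_le {v : ℕ → ℕ} {B : ℝ} (hB : 0 ≤ B) {j : ℕ} (hv : ∀ i < j, (v i : ℝ) ≤ B) :
    (regularize c v j : ℝ) ≤ B := by
  induction j with
  | zero => simpa only [regularize, Nat.cast_zero] using hB
  | succ j ih =>
    rw [regularize, Nat.cast_max, Nat.cast_min]
    exact max_le (ih fun i hi => hv i (hi.trans j.lt_succ_self))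
      (min_le_of_left_le (hv j j.lt_succ_self))

lemma le_regularize {v : ℕ → ℕ} {L : ℝ} (hL : L ≤ 0) {j : ℕ}
    (hv : ∀ i < j, L + c * (i + 1) ≤ v i) : L + c * j ≤ regularize c v j := by
  induction j with
  | zero => simpa only [regularize, Nat.cast_zero, mul_zero, add_zero] using hL
  | succ j ih =>
    have ih := ih fun i hi => hv i (hi.trans j.lt_succ_self)
    rw [regularize, Nat.cast_max, Nat.cast_min, Nat.cast_succ, Nat.cast_add]
    exact le_max_of_le_right (le_min (hv j j.lt_succ_self) (by linarith))

lemma SlopeLE.halveMesh {a : ℕ → ℕ} (ha : SlopeLE c a) : SlopeLE c (halveMesh a) := by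
  have hstep : ∀ j, a ((j - 1) / 2) ≤ a ((j + 1) / 2) ∧ a ((j + 1) / 2) ≤ a ((j - 1) / 2) + c
    | 0 => by simp
    | j + 1 => by
      rw [show (j + 1 + 1) / 2 = j / 2 + 1 by omega]
      exact ⟨ha.le_succ _, ha.succ_le _⟩
  constructor <;> intro j <;> have := hstep j <;>
    simp only [SolovayVariants.halveMesh, Nat.add_sub_cancel] <;> omega

lemma halveMesh_le {a : ℕ → ℕ} (ha : Monotone a) (j : ℕ) : halveMesh a j ≤ 2 * a (j / 2) := by
  have := ha (show (j - 1) / 2 ≤ j / 2 by omega)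
  rw [halveMesh]
  omega

lemma SlopeLE.le_halveMesh {a : ℕ → ℕ} (ha : SlopeLE c a) (j : ℕ) :
    2 * a (j / 2) ≤ SolovayVariants.halveMesh a j + c := by
  have h₁ := ha.monotone (show j / 2 ≤ (j - 1) / 2 + 1 by omega)
  have h₂ := ha.succ_le ((j - 1) / 2)
  rw [SolovayVariants.halveMesh]
  omega

end Sequences

/-! ### Limits of dyadic approximations -/

/-- The sequence `a n` lists values at the points `j / 2 ^ n`, in units of `2⁻ⁿ`. These are the
values of a monotone function with Lipschitz constant `c`, and they change by at most
`K / 2 ^ (n + 1)` from level `n` to level `n + 1`. -/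
structure IsDyadicScheme (c K : ℕ) (a : ℕ → ℕ → ℕ) : Prop where
  slopeLE : ∀ n, SlopeLE c (a n)
  two_mul_le : ∀ n j, 2 * a n (j / 2) ≤ a (n + 1) j + K
  le_two_mul : ∀ n j, a (n + 1) j ≤ 2 * a n (j / 2) + K

/-- The value at level `n` of the scheme `a` at the last grid point up to `x` (or at `0`). -/
noncomputable def dyadicApprox (a : ℕ → ℕ → ℕ) (x : ℝ) (n : ℕ) : ℝ := a n ⌊2 ^ n * x⌋₊ / 2 ^ n

/-- The real function approximated by the dyadic scheme `a`. -/
noncomputable def dyadicLimit (a : ℕ → ℕ → ℕ) (x : ℝ) : ℝ := limUnder atTop (dyadicApprox a x)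

lemma tendsto_const_div_two_pow (r : ℝ) : Tendsto (fun n : ℕ => r / 2 ^ n) atTop (𝓝 0) :=
  tendsto_const_nhds.div_atTop (tendsto_pow_atTop_atTop_of_one_lt one_lt_two)

namespace IsDyadicScheme

variable {c K : ℕ} {a : ℕ → ℕ → ℕ}

lemma dist_dyadicApprox_succ_le (ha : IsDyadicScheme c K a) (x : ℝ) (n : ℕ) :
    dist (dyadicApprox a x n) (dyadicApprox a x (n + 1)) ≤ K / 2 / 2 ^ n := by
  have hfloor : ⌊(2 : ℝ) ^ (n + 1) * x⌋₊ / 2 = ⌊(2 : ℝ) ^ n * x⌋₊ := by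
    rw [← Nat.floor_div_ofNat]
    congr 1
    ring
  have h₁ := ha.two_mul_le n ⌊(2 : ℝ) ^ (n + 1) * x⌋₊
  have h₂ := ha.le_two_mul n ⌊(2 : ℝ) ^ (n + 1) * x⌋₊
  rw [hfloor] at h₁ h₂
  rify at h₁ h₂
  have hdiff : dyadicApprox a x n - dyadicApprox a x (n + 1) =
      (2 * a n ⌊2 ^ n * x⌋₊ - a (n + 1) ⌊2 ^ (n + 1) * x⌋₊) / 2 / 2 ^ n := by
    rw [dyadicApprox, dyadicApprox]
    field_simp
    ring
  rw [Real.dist_eq, hdiff, abs_div, abs_div, abs_of_pos (two_pos (α := ℝ)),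
    abs_of_pos (pow_pos (two_pos (α := ℝ)) n)]
  gcongr
  rw [abs_le]
  constructor <;> linarith

lemma tendsto_dyadicApprox (ha : IsDyadicScheme c K a) (x : ℝ) :
    Tendsto (dyadicApprox a x) atTop (𝓝 (dyadicLimit a x)) :=
  (cauchySeq_of_le_geometric_two (ha.dist_dyadicApprox_succ_le x)).tendsto_limUnder

lemma abs_dyadicApprox_sub_dyadicLimit_le (ha : IsDyadicScheme c K a) (x : ℝ) (n : ℕ) :
    |dyadicApprox a x n - dyadicLimit a x| ≤ K / 2 ^ n :=
  dist_le_of_le_geometric_two_of_tendsto (ha.dist_dyadicApprox_succ_le x)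
    (ha.tendsto_dyadicApprox x) n

lemma dyadicLimit_nonneg (ha : IsDyadicScheme c K a) (x : ℝ) : 0 ≤ dyadicLimit a x :=
  ge_of_tendsto' (ha.tendsto_dyadicApprox x) fun n => by unfold dyadicApprox; positivity

lemma monotone_dyadicLimit (ha : IsDyadicScheme c K a) : Monotone (dyadicLimit a) :=
  fun x y hxy =>
    le_of_tendsto_of_tendsto' (ha.tendsto_dyadicApprox x) (ha.tendsto_dyadicApprox y) fun n => by
      have := (ha.slopeLE n).monotone (Nat.floor_mono (show 2 ^ n * x ≤ 2 ^ n * y by gcongr))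
      unfold dyadicApprox
      gcongr

lemma dyadicLimit_le_add (ha : IsDyadicScheme c K a) {x y : ℝ} (hxy : x ≤ y) :
    dyadicLimit a y ≤ dyadicLimit a x + c * (y - x) := by
  have hlim : Tendsto (fun n => dyadicApprox a x n + c * (y - x) + c / 2 ^ n) atTop
      (𝓝 (dyadicLimit a x + c * (y - x))) := by
    simpa only [add_zero] using
      ((ha.tendsto_dyadicApprox x).add_const _).add (tendsto_const_div_two_pow (c : ℝ))
  refine le_of_tendsto_of_tendsto' (ha.tendsto_dyadicApprox y) hlim fun n => ?_
  have h := (ha.slopeLE n).floor_le (show 2 ^ n * x ≤ 2 ^ n * y by gcongr)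
  calc dyadicApprox a y n
      ≤ (a n ⌊2 ^ n * x⌋₊ + c * (2 ^ n * y - 2 ^ n * x + 1)) / 2 ^ n := by
        unfold dyadicApprox
        gcongr
    _ = dyadicApprox a x n + c * (y - x) + c / 2 ^ n := by
        unfold dyadicApprox
        field_simp
        ring

lemma lipschitzWith_dyadicLimit (ha : IsDyadicScheme c K a) :
    LipschitzWith c (dyadicLimit a) := by
  refine LipschitzWith.of_le_add_mul _ fun x y => ?_
  rcases le_total x y with h | h
  · exact (ha.monotone_dyadicLimit h).trans (le_add_of_nonneg_right (by positivity))
  · rw [Real.dist_eq, abs_of_nonneg (sub_nonneg.2 h)]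
    exact_mod_cast ha.dyadicLimit_le_add h

end IsDyadicScheme

/-! ### The function generated by grid data -/

/-- The dyadic scheme generated by data `G n j` on the dyadic intervals of level `n`: at each level
the regularized data are moved into a band of width `2 * c + 1` above the values of the previous
level. -/
def gridApprox (c : ℕ) (G : ℕ → ℕ → ℕ) : ℕ → ℕ → ℕ
  | 0 => regularize c (G 0)
  | n + 1 => halveMesh (gridApprox c G n) ⊔
      (regularize c (G (n + 1)) ⊓ fun j => halveMesh (gridApprox c G n) j + (2 * c + 1))

lemma isDyadicScheme_gridApprox (c : ℕ) (G : ℕ → ℕ → ℕ) :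
    IsDyadicScheme c (2 * c + 1) (gridApprox c G) := by
  have hslope : ∀ n, SlopeLE c (gridApprox c G n) := by
    intro n
    induction n with
    | zero => exact slopeLE_regularize c (G 0)
    | succ n ih =>
      exact ih.halveMesh.sup ((slopeLE_regularize c _).inf (ih.halveMesh.add_const _))
  refine ⟨hslope, fun n j => ?_, fun n j => ?_⟩
  · have h : halveMesh (gridApprox c G n) j ≤ gridApprox c G (n + 1) j := le_sup_left
    have := (hslope n).le_halveMesh j
    omega
  · have h : gridApprox c G (n + 1) j ≤ halveMesh (gridApprox c G n) j + (2 * c + 1) :=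
      sup_le (Nat.le_add_right _ _) inf_le_right
    have := halveMesh_le (hslope n).monotone j
    omega

/-- The pairs `(n, j)` for which the grid point `j / 2 ^ n` lies to the left of `b`. -/
def gridBelow (b : ℝ) : Set (ℕ × ℕ) := {p | (p.2 : ℝ) < 2 ^ p.1 * b}

section GridBelow

variable {b : ℝ} {n j : ℕ}

lemma mem_gridBelow : (n, j) ∈ gridBelow b ↔ (j : ℝ) < 2 ^ n * b := Iff.rfl

lemma mem_gridBelow_of_le {i : ℕ} (hij : i ≤ j) (h : (n, j) ∈ gridBelow b) :
    (n, i) ∈ gridBelow b :=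
  mem_gridBelow.2 ((Nat.cast_le.2 hij).trans_lt (mem_gridBelow.1 h))

lemma mem_gridBelow_of_two_mul_le {i : ℕ} (hij : 2 * i ≤ j) (h : (n + 1, j) ∈ gridBelow b) :
    (n, i) ∈ gridBelow b := by
  have h' : ((2 * i : ℕ) : ℝ) < 2 ^ (n + 1) * b :=
    (Nat.cast_le.2 hij).trans_lt (mem_gridBelow.1 h)
  push_cast [pow_succ] at h'
  rw [mem_gridBelow]
  linarith

lemma floor_mem_gridBelow {x : ℝ} (hx : 0 ≤ x) (hxb : x < b) (n : ℕ) :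
    (n, ⌊2 ^ n * x⌋₊) ∈ gridBelow b :=
  mem_gridBelow.2 ((Nat.floor_le (by positivity)).trans_lt (by gcongr))

end GridBelow

section Bounds

variable {c : ℕ} {G : ℕ → ℕ → ℕ} {b x : ℝ}

lemma gridApprox_le {A : ℝ} (hA : 0 ≤ A)
    (hG : ∀ n j, (n, j + 1) ∈ gridBelow b → (G n j : ℝ) ≤ 2 ^ n * A) (n j : ℕ)
    (hj : (n, j) ∈ gridBelow b) : (gridApprox c G n j : ℝ) ≤ 2 ^ n * A := by
  have hreg : ∀ n j, (n, j) ∈ gridBelow b → (regularize c (G n) j : ℝ) ≤ 2 ^ n * A :=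
    fun n j hj => regularize_le (by positivity) fun i hi => hG n i (mem_gridBelow_of_le hi hj)
  induction n generalizing j with
  | zero => exact hreg 0 j hj
  | succ n ih =>
    have h₁ := ih _ (mem_gridBelow_of_two_mul_le (show 2 * (j / 2) ≤ j by omega) hj)
    have h₂ := ih _ (mem_gridBelow_of_two_mul_le (show 2 * ((j - 1) / 2) ≤ j by omega) hj)
    simp only [gridApprox, Pi.sup_apply, Pi.inf_apply, Nat.cast_max, Nat.cast_min]
    refine max_le ?_ (min_le_of_left_le (hreg (n + 1) j hj))
    rw [halveMesh, Nat.cast_add, pow_succ]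
    linarith

lemma le_gridApprox {d : ℝ} (hd : d ≤ 0)
    (hG : ∀ n j, (n, j + 1) ∈ gridBelow b → 2 ^ n * d + c * (j + 1) - (c + 1) ≤ G n j) (n j : ℕ)
    (hj : (n, j) ∈ gridBelow b) : 2 ^ n * d + c * j - (c + 1) ≤ gridApprox c G n j := by
  have hreg : ∀ n j, (n, j) ∈ gridBelow b →
      2 ^ n * d + c * j - (c + 1) ≤ regularize c (G n) j := by
    intro n j hj
    have hL : 2 ^ n * d - (c + 1) ≤ 0 := by
      have : 2 ^ n * d ≤ 0 := mul_nonpos_of_nonneg_of_nonpos (by positivity) hd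
      linarith [c.cast_nonneg (α := ℝ)]
    have hv : ∀ i < j, 2 ^ n * d - (c + 1) + c * (i + 1) ≤ G n i := fun i hi => by
      linarith [hG n i (mem_gridBelow_of_le hi hj)]
    linarith [le_regularize hL hv]
  induction n generalizing j with
  | zero => exact hreg 0 j hj
  | succ n ih =>
    have h₁ := ih _ (mem_gridBelow_of_two_mul_le (show 2 * (j / 2) ≤ j by omega) hj)
    have h₂ := ih _ (mem_gridBelow_of_two_mul_le (show 2 * ((j - 1) / 2) ≤ j by omega) hj)
    have h₃ : (c : ℝ) * j ≤ c * (j / 2 : ℕ) + c * ((j - 1) / 2 : ℕ) + c := by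
      exact_mod_cast (Nat.mul_le_mul_left c (show j ≤ j / 2 + (j - 1) / 2 + 1 by omega)).trans_eq
        (by ring)
    simp only [gridApprox, Pi.sup_apply, Pi.inf_apply, Nat.cast_max, Nat.cast_min]
    refine le_max_of_le_right (le_min (hreg (n + 1) j hj) ?_)
    rw [halveMesh, pow_succ]
    push_cast
    linarith

lemma dyadicLimit_gridApprox_le {A : ℝ} (hA : 0 ≤ A)
    (hG : ∀ n j, (n, j + 1) ∈ gridBelow b → (G n j : ℝ) ≤ 2 ^ n * A) (hx : x ∈ Set.Ico 0 b) :
    dyadicLimit (gridApprox c G) x ≤ A :=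
  le_of_tendsto' ((isDyadicScheme_gridApprox c G).tendsto_dyadicApprox x) fun n =>
    div_le_of_le_mul₀ (by positivity) hA <| by
      rw [mul_comm A]
      exact gridApprox_le hA hG n _ (floor_mem_gridBelow hx.1 hx.2 n)

lemma le_dyadicLimit_gridApprox {d : ℝ} (hd : d ≤ 0)
    (hG : ∀ n j, (n, j + 1) ∈ gridBelow b → 2 ^ n * d + c * (j + 1) - (c + 1) ≤ G n j)
    (hx : x ∈ Set.Ico 0 b) : d + c * x ≤ dyadicLimit (gridApprox c G) x := by
  have hlim : Tendsto (fun n : ℕ => d + c * x - (2 * c + 1) / 2 ^ n) atTop (𝓝 (d + c * x)) := by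
    simpa only [sub_zero] using tendsto_const_nhds.sub (tendsto_const_div_two_pow (2 * c + 1 : ℝ))
  refine le_of_tendsto_of_tendsto' hlim
    ((isDyadicScheme_gridApprox c G).tendsto_dyadicApprox x) fun n => ?_
  have h := le_gridApprox hd hG n _ (floor_mem_gridBelow hx.1 hx.2 n)
  have hfloor : (c : ℝ) * (2 ^ n * x - 1) ≤ c * ⌊2 ^ n * x⌋₊ := by
    gcongr
    exact (Nat.sub_one_lt_floor _).le
  rw [dyadicApprox, le_div_iff₀ (by positivity), sub_mul,
    div_mul_cancel₀ _ (by positivity : (2 : ℝ) ^ n ≠ 0)]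
  linarith

end Bounds

/-! ### Codes of rationals -/

/-- The midpoint of the `j`-th interval of the dyadic grid of level `n`. Midpoints serve as dyadic
approximations since their numerators and denominators are coprime. -/
def dyadicMid (n j : ℕ) : ℚ := (2 * j + 1) / 2 ^ (n + 1)

lemma cast_dyadicMid (n j : ℕ) : (dyadicMid n j : ℝ) = (j + 1 / 2) / 2 ^ n := by
  rw [dyadicMid]
  push_cast [pow_succ]
  field_simp

lemma ratCode_dyadicMid (n j : ℕ) :
    ratCode (dyadicMid n j) = Nat.pair (2 * (2 * j + 1)) (2 ^ (n + 1)) := by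
  have hcop : Nat.Coprime (2 * j + 1 : ℤ).natAbs (2 ^ (n + 1) : ℤ).natAbs := by
    rw [Int.natAbs_pow]
    exact Nat.Coprime.pow_right _ (Nat.coprime_two_right.2 ⟨j, by omega⟩)
  have hcast : dyadicMid n j = ((2 * j + 1 : ℤ) : ℚ) / ((2 ^ (n + 1) : ℤ) : ℚ) := by
    push_cast
    rfl
  have hnum : (dyadicMid n j).num = (2 * j + 1 : ℕ) := by
    rw [hcast, Rat.num_div_eq_of_coprime (by positivity) hcop]
    push_cast
    rfl
  have hden : (dyadicMid n j).den = 2 ^ (n + 1) := by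
    have := Rat.den_div_eq_of_coprime (by positivity) hcop
    rw [← hcast] at this
    exact_mod_cast this
  rw [ratCode, hnum, hden]
  rfl

lemma primrec_two_pow : Primrec fun n : ℕ => 2 ^ n :=
  (Primrec₂.unpaired'.1 Nat.Primrec.pow).comp (Primrec.const 2) Primrec.id

lemma primrec₂_ratCode_dyadicMid : Primrec₂ fun n j : ℕ => ratCode (dyadicMid n j) := by
  have hnum : Primrec fun j : ℕ => 2 * (2 * j + 1) :=
    Primrec.nat_double.comp Primrec.nat_double_succ
  have hden : Primrec fun n : ℕ => 2 ^ (n + 1) := primrec_two_pow.comp Primrec.succ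
  exact (Primrec₂.natPair.comp (hnum.comp Primrec.snd) (hden.comp Primrec.fst)).of_eq fun _ =>
    (ratCode_dyadicMid _ _).symm

/-- The floor of `2 ^ n * r`, computed from the code `k` of the rational `r`. Nonnegative numerators
have even codes; the first factor makes the result `0` for the negative ones. -/
def floorCode (n k : ℕ) : ℕ := (1 - k.unpair.1 % 2) * (k.unpair.1 / 2 * 2 ^ n / k.unpair.2)

lemma primrec₂_floorCode : Primrec₂ floorCode := by
  have hnum : Primrec₂ fun _ k : ℕ => k.unpair.1 :=
    (Primrec.fst.comp Primrec.unpair).comp Primrec.snd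
  have hden : Primrec₂ fun _ k : ℕ => k.unpair.2 :=
    (Primrec.snd.comp Primrec.unpair).comp Primrec.snd
  have hpow : Primrec₂ fun n _ : ℕ => 2 ^ n := primrec_two_pow.comp Primrec.fst
  have hsign := Primrec.nat_sub.comp₂ (Primrec₂.const 1)
    (Primrec.nat_mod.comp₂ hnum (Primrec₂.const 2))
  have hscaled := Primrec.nat_mul.comp₂ (Primrec.nat_div.comp₂ hnum (Primrec₂.const 2)) hpow
  exact Primrec.nat_mul.comp₂ hsign (Primrec.nat_div.comp₂ hscaled hden)

lemma floorCode_ratCode (n : ℕ) (r : ℚ) : floorCode n (ratCode r) = ⌊2 ^ n * (r : ℝ)⌋₊ := by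
  rw [floorCode, ratCode, Nat.unpair_pair]
  rcases hnum : r.num with m | m
  · have hr : 2 ^ n * (r : ℝ) = ((m * 2 ^ n : ℕ) : ℝ) / r.den := by
      rw [Rat.cast_def r, hnum, Int.ofNat_eq_natCast, Int.cast_natCast]
      push_cast
      ring
    have hcode : Encodable.encode (Int.ofNat m) = 2 * m := rfl
    rw [hcode, hr, Nat.floor_div_natCast, Nat.floor_natCast]
    simp
  · have hr : (r : ℝ) ≤ 0 := Rat.cast_nonpos.2 <| Rat.num_nonpos.1 <| by
      rw [hnum]
      exact (Int.negSucc_lt_zero m).le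
    have hcode : Encodable.encode (Int.negSucc m) % 2 = 1 := Nat.mul_add_mod 2 m 1
    rw [hcode, Nat.sub_self, zero_mul,
      Nat.floor_of_nonpos (mul_nonpos_of_nonneg_of_nonpos (by positivity) hr)]

/-! ### Partial computability on a part of the grid -/

/-- A machine computes `F n j` for all `(n, j)` in `D`; nothing is required of its results
elsewhere. -/
def PartrecOn (D : Set (ℕ × ℕ)) (F : ℕ → ℕ → ℕ) : Prop :=
  ∃ ψ : ℕ → ℕ →. ℕ, Partrec₂ ψ ∧ ∀ n j, (n, j) ∈ D → F n j ∈ ψ n j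

lemma partrecOn_regularize (c : ℕ) {b : ℝ} {G : ℕ → ℕ → ℕ}
    (hG : PartrecOn {p | (p.1, p.2 + 1) ∈ gridBelow b} G) :
    PartrecOn (gridBelow b) fun n => regularize c (G n) := by
  obtain ⟨ψ, hψ, hψG⟩ := hG
  have hstep : Primrec₂ fun r v : ℕ => max r (min v (r + c)) :=
    Primrec.nat_max.comp Primrec.fst
      (Primrec.nat_min.comp Primrec.snd (Primrec.nat_add.comp Primrec.fst (Primrec.const c)))
  have hrow : Partrec₂ fun (p : ℕ × ℕ) (q : ℕ × ℕ) =>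
      (ψ p.1 q.1).map fun v => max q.2 (min v (q.2 + c)) :=
    (hψ.comp (Computable.fst.comp Computable.fst) (Computable.fst.comp Computable.snd)).map
      (hstep.to_comp.comp (Computable.snd.comp (Computable.snd.comp Computable.fst))
        Computable.snd)
  refine ⟨_, (Partrec.nat_rec Computable.snd (Computable.const 0).partrec hrow).to₂,
    fun n j hj => ?_⟩
  induction j with
  | zero => exact Part.mem_some 0
  | succ j ih =>
    exact Part.mem_bind (ih (mem_gridBelow_of_le j.le_succ hj))
      (Part.mem_map (fun v => max _ (min v (_ + c))) (hψG n j hj))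

lemma partrec_map₃ {α : Type*} [Primcodable α] {u v w : α →. ℕ} (hu : Partrec u)
    (hv : Partrec v) (hw : Partrec w) {S : ℕ × ℕ × ℕ → ℕ} (hS : Computable S) :
    Partrec fun a => (u a).bind fun x => (v a).bind fun y => (w a).map fun z => S (x, y, z) := by
  have hcombine : Computable₂ fun (p : (α × ℕ) × ℕ) (z : ℕ) => S (p.1.2, p.2, z) :=
    hS.comp (((Computable.snd.comp Computable.fst).comp Computable.fst).pair
      ((Computable.snd.comp Computable.fst).pair Computable.snd))
  have hlast : Partrec₂ fun (p : α × ℕ) (y : ℕ) => (w p.1).map fun z => S (p.2, y, z) :=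
    ((hw.comp Computable.fst).comp Computable.fst).map hcombine
  exact hu.bind ((hv.comp Computable.fst).bind hlast).to₂

/-- Each value requires two values of the previous level, so the program is obtained from the
recursion theorem. -/
lemma PartrecOn.levelRec {D : Set (ℕ × ℕ)} {F R : ℕ → ℕ → ℕ} (hR : PartrecOn D R) {f g : ℕ → ℕ}
    (hf : Computable f) (hg : Computable g) (hDf : ∀ n j, (n + 1, j) ∈ D → (n, f j) ∈ D)
    (hDg : ∀ n j, (n + 1, j) ∈ D → (n, g j) ∈ D) {S : ℕ × ℕ × ℕ → ℕ} (hS : Computable S)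
    (hzero : ∀ j, F 0 j = R 0 j)
    (hsucc : ∀ n j, F (n + 1) j = S (F n (f j), F n (g j), R (n + 1) j)) : PartrecOn D F := by
  obtain ⟨ψ, hψ, hψR⟩ := hR
  let prev (e : Nat.Partrec.Code) (n i : ℕ) : Part ℕ := e.eval (Nat.pair (n - 1) i)
  let next (e : Nat.Partrec.Code) (n j : ℕ) : Part ℕ :=
    (prev e n (f j)).bind fun u => (prev e n (g j)).bind fun v => (ψ n j).map fun w => S (u, v, w)
  let body (e : Nat.Partrec.Code) (k : ℕ) : Part ℕ :=
    bif k.unpair.1 == 0 then ψ k.unpair.1 k.unpair.2 else next e k.unpair.1 k.unpair.2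
  have hbody : Partrec₂ body := by
    have hn : Computable fun p : Nat.Partrec.Code × ℕ => p.2.unpair.1 :=
      (Primrec.fst.comp (Primrec.unpair.comp Primrec.snd)).to_comp
    have hj : Computable fun p : Nat.Partrec.Code × ℕ => p.2.unpair.2 :=
      (Primrec.snd.comp (Primrec.unpair.comp Primrec.snd)).to_comp
    have hprev {i : ℕ → ℕ} (hi : Computable i) :
        Partrec fun p : Nat.Partrec.Code × ℕ => prev p.1 p.2.unpair.1 (i p.2.unpair.2) :=
      Nat.Partrec.Code.eval_part.comp Computable.fst
        (Primrec₂.natPair.to_comp.comp (Computable.pred.comp hn) (hi.comp hj))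
    exact Partrec.cond (Primrec.beq.to_comp.comp hn (Computable.const 0)) (hψ.comp hn hj)
      (partrec_map₃ (hprev hf) (hprev hg) (hψ.comp hn hj) hS)
  obtain ⟨e, he⟩ := Nat.Partrec.Code.fixed_point₂ hbody
  suffices heval : ∀ n j, (n, j) ∈ D → F n j ∈ e.eval (Nat.pair n j) from
    ⟨_, (Nat.Partrec.Code.eval_part.comp (Computable.const e) Primrec₂.natPair.to_comp).to₂, heval⟩
  intro n
  induction n with
  | zero =>
    intro j hj
    rw [he, hzero]
    simpa only [body, Nat.unpair_pair, beq_self_eq_true, cond_true] using hψR 0 j hj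
  | succ n ih =>
    intro j hj
    rw [he, hsucc]
    simp only [body, next, prev, Nat.unpair_pair, Nat.reduceBeqDiff, cond_false, Nat.add_sub_cancel]
    exact Part.mem_bind_iff.2 ⟨_, ih _ (hDf n j hj), Part.mem_bind_iff.2 ⟨_, ih _ (hDg n j hj),
      Part.mem_map (fun w => S (_, _, w)) (hψR (n + 1) j hj)⟩⟩

lemma partrecOn_gridApprox (c : ℕ) {b : ℝ} {G : ℕ → ℕ → ℕ}
    (hG : PartrecOn {p | (p.1, p.2 + 1) ∈ gridBelow b} G) :
    PartrecOn (gridBelow b) (gridApprox c G) := by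
  have hhalf : Primrec fun j : ℕ => j / 2 := Primrec.nat_div.comp Primrec.id (Primrec.const 2)
  have hsum : Primrec fun t : ℕ × ℕ × ℕ => t.1 + t.2.1 :=
    Primrec.nat_add.comp Primrec.fst (Primrec.fst.comp Primrec.snd)
  have hstep : Primrec fun t : ℕ × ℕ × ℕ =>
      max (t.1 + t.2.1) (min t.2.2 (t.1 + t.2.1 + (2 * c + 1))) :=
    Primrec.nat_max.comp hsum (Primrec.nat_min.comp (Primrec.snd.comp Primrec.snd)
      (Primrec.nat_add.comp hsum (Primrec.const (2 * c + 1))))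
  exact (partrecOn_regularize c hG).levelRec hhalf.to_comp (hhalf.comp Primrec.pred).to_comp
    (fun _ _ => mem_gridBelow_of_two_mul_le (Nat.mul_div_le _ 2))
    (fun _ _ => mem_gridBelow_of_two_mul_le ((Nat.mul_div_le _ 2).trans (Nat.sub_le _ 1)))
    hstep.to_comp (fun _ => rfl) fun _ _ => rfl

/-! ### Oracle machines -/

lemma exists_oracleMachine_of_partrec {φ : ℕ →. ℕ} (hφ : Nat.Partrec φ) :
    ∃ M : OracleMachine, ∀ O : ℕ → ℕ, M.eval O = φ := by
  induction hφ with
  | zero => exact ⟨.zero, fun _ => rfl⟩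
  | succ => exact ⟨.succ, fun _ => rfl⟩
  | left => exact ⟨.left, fun _ => rfl⟩
  | right => exact ⟨.right, fun _ => rfl⟩
  | pair _ _ ihf ihg =>
    obtain ⟨M, hM⟩ := ihf
    obtain ⟨N, hN⟩ := ihg
    refine ⟨.pair M N, fun O => funext fun n => ?_⟩
    simp [OracleMachine.eval, hM, hN, Seq.seq, Part.bind_map]
  | comp _ _ ihf ihg =>
    obtain ⟨M, hM⟩ := ihf
    obtain ⟨N, hN⟩ := ihg
    refine ⟨.comp M N, fun O => funext fun n => ?_⟩
    simp only [OracleMachine.eval, hM, hN]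
    rfl
  | prec _ _ ihf ihg =>
    obtain ⟨M, hM⟩ := ihf
    obtain ⟨N, hN⟩ := ihg
    refine ⟨.prec M N, fun O => funext fun n => ?_⟩
    simp [OracleMachine.eval, hM, hN, Nat.unpaired]
  | rfind _ ihf =>
    obtain ⟨M, hM⟩ := ihf
    refine ⟨.rfind M, fun O => funext fun n => ?_⟩
    simp [OracleMachine.eval, hM]

lemma exists_oracleMachine_query {Φ : ℕ → ℕ →. ℕ} (hΦ : Partrec₂ Φ) (s : ℕ) :
    ∃ M : OracleMachine, ∀ (O : ℕ → ℕ) (n : ℕ), M.eval O n = Φ n (O (n + s)) := by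
  obtain ⟨M, hM⟩ := exists_oracleMachine_of_partrec (Partrec₂.unpaired'.2 hΦ)
  obtain ⟨I, hI⟩ := exists_oracleMachine_of_partrec Nat.Partrec.some
  obtain ⟨S, hS⟩ := exists_oracleMachine_of_partrec (φ := fun n => Part.some (n + s))
    (Partrec.nat_iff.1 (Primrec.nat_add.comp Primrec.id (Primrec.const s)).to_comp)
  refine ⟨.comp M (.pair I (.comp .oracle S)), fun O n => ?_⟩
  simp only [OracleMachine.eval, hM, hI, hS, Part.bind_some, Part.map_some]
  simp only [Nat.unpaired, Nat.unpair_pair]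

namespace OracleMachine

lemma partrec_eval {O : ℕ → ℕ} (hO : Computable O) (M : OracleMachine) :
    Nat.Partrec (M.eval O) := by
  induction M with
  | zero => exact .zero
  | succ => exact .succ
  | left => exact .left
  | right => exact .right
  | oracle => exact Partrec.nat_iff.1 hO
  | pair M N ihM ihN =>
    refine (ihM.pair ihN).of_eq fun n => ?_
    simp [eval, Seq.seq, Part.bind_map]
  | comp M N ihM ihN => exact ihM.comp ihN
  | prec M N ihM ihN =>
    refine (ihM.prec ihN).of_eq fun n => ?_
    simp [eval, Nat.unpaired]
  | rfind M ihM =>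
    refine ihM.rfind.of_eq fun n => ?_
    simp [eval]

end OracleMachine

lemma computableReal_ratCast (r : ℚ) : ComputableReal r :=
  ⟨fun _ => r, Computable.const _, fun n => by simp, tendsto_const_nhds⟩

namespace ComputableOn

variable {f : ℝ → ℝ} {X Y : Set ℝ} {x : ℝ}

protected lemma mono (hf : ComputableOn f X) (hYX : Y ⊆ X) : ComputableOn f Y :=
  hf.imp fun _ hM x hx => hM x (hYX hx)

protected lemma computableReal (hf : ComputableOn f X) (hx : x ∈ X) (hcomp : ComputableReal x) :
    ComputableReal (f x) := by
  obtain ⟨M, hM⟩ := hf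
  obtain ⟨p, hp, hpx⟩ := hcomp
  obtain ⟨q, hq, hqx⟩ := hM x hx p hpx
  exact ⟨q, (Partrec.nat_iff.2 (M.partrec_eval hp)).of_eq_tot hq, hqx⟩

/-- A monotone function that attains an upper bound `α` at some point is constantly `α` from there
on, in particular at a rational, so `α` is computable. -/
lemma lt_of_not_computableReal {α β : ℝ} (hf : ComputableOn f (Set.Ico 0 β))
    (hmono : MonotoneOn f (Set.Ico 0 β)) (hle : ∀ y ∈ Set.Ico 0 β, f y ≤ α)
    (hα : ¬ ComputableReal α) (hx : x ∈ Set.Ico 0 β) : f x < α := by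
  obtain ⟨r, hxr, hrβ⟩ := exists_rat_btwn hx.2
  have hr : (r : ℝ) ∈ Set.Ico 0 β := ⟨hx.1.trans hxr.le, hrβ⟩
  have hne : f r ≠ α := fun h => hα (h ▸ hf.computableReal hr (computableReal_ratCast r))
  exact (hmono hx hr hxr.le).trans_lt ((hle r hr).lt_of_ne hne)

end ComputableOn

/-! ### Effective approximations -/

lemma IsEffectiveApprox.abs_sub_le {p : ℕ → ℚ} {x : ℝ} (hp : IsEffectiveApprox p x) (n : ℕ) :
    |(p n : ℝ) - x| ≤ 2 / 2 ^ n := by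
  refine dist_le_of_le_geometric_two_of_tendsto (f := fun n => (p n : ℝ)) (fun n => ?_) hp.2 n
  have h := (Rat.cast_lt (K := ℝ)).2 (hp.1 n)
  push_cast at h
  simpa [Real.dist_eq, div_eq_mul_inv] using h.le

lemma isEffectiveApprox_of_abs_sub_le {q : ℕ → ℚ} {y : ℝ}
    (h : ∀ n, |(q n : ℝ) - y| ≤ 1 / 2 / 2 ^ n) : IsEffectiveApprox q y := by
  constructor
  · intro n
    have hlt : |(q n : ℝ) - q (n + 1)| < (1 / 2) ^ n := calc
      |(q n : ℝ) - q (n + 1)| ≤ |(q n : ℝ) - y| + |y - q (n + 1)| := abs_sub_le _ _ _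
      _ ≤ 1 / 2 / 2 ^ n + 1 / 2 / 2 ^ (n + 1) :=
        add_le_add (h n) ((abs_sub_comm _ _).trans_le (h (n + 1)))
      _ < (1 / 2) ^ n := by
        rw [one_div_pow, pow_succ]
        field_simp
        norm_num
    rw [← Rat.cast_lt (K := ℝ)]
    push_cast
    exact hlt
  · rw [tendsto_iff_dist_tendsto_zero]
    exact squeeze_zero (fun _ => dist_nonneg) h (tendsto_const_div_two_pow (1 / 2))

/-! ### Computability of the limit of a dyadic scheme -/

section DyadicLimit

variable {c K : ℕ} {a : ℕ → ℕ → ℕ} {b x : ℝ} {r : ℚ} {n : ℕ}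

lemma abs_two_pow_mul_sub_le (hr : |(r : ℝ) - x| ≤ 2 / 2 ^ n) :
    |2 ^ n * (r : ℝ) - 2 ^ n * x| ≤ 2 := by
  rw [← mul_sub, abs_mul, abs_of_pos (by positivity), mul_comm]
  exact (le_div_iff₀ (by positivity)).1 hr

lemma floor_sub_two_mem_gridBelow (hx : x ∈ Set.Ico 0 b) (hr : |(r : ℝ) - x| ≤ 2 / 2 ^ n) :
    (n, ⌊2 ^ n * (r : ℝ)⌋₊ - 2) ∈ gridBelow b := by
  refine mem_gridBelow_of_le ?_ (floor_mem_gridBelow hx.1 hx.2 n)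
  rw [← Nat.floor_sub_ofNat]
  exact Nat.floor_mono (sub_le_comm.1 (abs_le.1 (abs_two_pow_mul_sub_le hr)).2)

lemma IsDyadicScheme.abs_dyadicMid_sub_dyadicLimit_le (ha : IsDyadicScheme c K a)
    (hr : |(r : ℝ) - x| ≤ 2 / 2 ^ n) :
    |(dyadicMid n (a n (⌊2 ^ n * (r : ℝ)⌋₊ - 2)) : ℝ) - dyadicLimit a x| ≤
      (5 * c + K + 1) / 2 ^ n := by
  have hrx := abs_le.1 (abs_two_pow_mul_sub_le hr)
  have hle : 2 ^ n * (r : ℝ) - 2 ≤ 2 ^ n * x := by linarith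
  have hmono : (a n ⌊2 ^ n * (r : ℝ) - 2⌋₊ : ℝ) ≤ a n ⌊2 ^ n * x⌋₊ :=
    Nat.cast_le.2 ((ha.slopeLE n).monotone (Nat.floor_mono hle))
  have hslope : (a n ⌊2 ^ n * x⌋₊ : ℝ) ≤ a n ⌊2 ^ n * (r : ℝ) - 2⌋₊ + c * 5 :=
    ((ha.slopeLE n).floor_le hle).trans (by gcongr; linarith)
  have hmid : |(dyadicMid n (a n (⌊2 ^ n * (r : ℝ)⌋₊ - 2)) : ℝ) - dyadicApprox a x n| ≤
      (5 * c + 1) / 2 ^ n := by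
    rw [cast_dyadicMid, dyadicApprox, ← Nat.floor_sub_ofNat, ← sub_div, abs_div,
      abs_of_pos (by positivity : (0 : ℝ) < 2 ^ n)]
    gcongr
    rw [abs_le]
    constructor <;> linarith
  calc |(dyadicMid n (a n (⌊2 ^ n * (r : ℝ)⌋₊ - 2)) : ℝ) - dyadicLimit a x|
      ≤ (5 * c + 1) / 2 ^ n + K / 2 ^ n :=
        (_root_.abs_sub_le _ _ _).trans
          (add_le_add hmid (ha.abs_dyadicApprox_sub_dyadicLimit_le x n))
    _ = (5 * c + K + 1) / 2 ^ n := by ring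

lemma IsDyadicScheme.computableOn_dyadicLimit (ha : IsDyadicScheme c K a)
    (hcomp : PartrecOn (gridBelow b) a) : ComputableOn (dyadicLimit a) (Set.Ico 0 b) := by
  obtain ⟨ψ, hψ, hψa⟩ := hcomp
  -- `s` extra levels turn an error of `5 * c + K + 1` mesh units into at most `2⁻ⁿ / 2`.
  let s := 2 * (5 * c + K + 1)
  let query (n k : ℕ) : Part ℕ :=
    (ψ (n + s) (floorCode (n + s) k - 2)).map fun v => ratCode (dyadicMid (n + s) v)
  have hquery : Partrec₂ query := by
    have hlevel : Primrec fun p : ℕ × ℕ => p.1 + s := Primrec.nat_add.comp Primrec.fst (.const s)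
    have hindex : Primrec fun p : ℕ × ℕ => floorCode (p.1 + s) p.2 - 2 :=
      Primrec.nat_sub.comp (primrec₂_floorCode.comp hlevel Primrec.snd) (.const 2)
    have hout : Primrec₂ fun (p : ℕ × ℕ) v => ratCode (dyadicMid (p.1 + s) v) :=
      primrec₂_ratCode_dyadicMid.comp (hlevel.comp Primrec.fst) Primrec.snd
    exact (hψ.comp hlevel.to_comp hindex.to_comp).map hout.to_comp
  obtain ⟨M, hM⟩ := exists_oracleMachine_query hquery s
  refine ⟨M, fun x hx p hp => ⟨fun n => dyadicMid (n + s)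
    (a (n + s) (⌊2 ^ (n + s) * (p (n + s) : ℝ)⌋₊ - 2)), fun n => ?_,
    isEffectiveApprox_of_abs_sub_le fun n => ?_⟩⟩
  · rw [hM]
    simp only [query, floorCode_ratCode]
    exact Part.mem_map (fun v => ratCode (dyadicMid (n + s) v))
      (hψa _ _ (floor_sub_two_mem_gridBelow hx (hp.abs_sub_le _)))
  · have hs : 2 * (5 * c + K + 1 : ℝ) ≤ 2 ^ s := by
      exact_mod_cast (Nat.lt_two_pow_self (n := s)).le
    refine (ha.abs_dyadicMid_sub_dyadicLimit_le (hp.abs_sub_le _)).trans ?_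
    rw [div_div, div_le_div_iff₀ (by positivity) (by positivity), pow_add]
    nlinarith [show (0 : ℝ) < 2 ^ n by positivity]

end DyadicLimit

/-! ### The function obtained from a translation function -/

open Classical in
/-- The value of `g` at the midpoint of the `j`-th dyadic interval of level `n`, in units of `2⁻ⁿ`
and rounded down. The index is reduced modulo `2 ^ n` so that the midpoint lies in `[0,1)`, and
undefined values count as `0`. -/
noncomputable def cellData (g : ℚ →. ℚ) (n j : ℕ) : ℕ :=
  ⌊2 ^ n * (((g (dyadicMid n (j % 2 ^ n))).getOrElse 0 : ℚ) : ℝ)⌋₊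

/-- The monotone, `c`-Lipschitz function generated by the values of `g` at dyadic rationals. -/
noncomputable def interpolant (c : ℕ) (g : ℚ →. ℚ) : ℝ → ℝ :=
  dyadicLimit (gridApprox c (cellData g))

section Translation

variable {g : ℚ →. ℚ} {c n j : ℕ} {α β : ℝ} {r : ℚ}

lemma cellData_eq_floor (hr : r ∈ g (dyadicMid n (j % 2 ^ n))) :
    cellData g n j = ⌊2 ^ n * (r : ℝ)⌋₊ := by
  classical
  rw [cellData, Part.getOrElse_of_dom _ hr.1, Part.get_eq_of_mem hr hr.1]

lemma dyadicMid_mod_mem_Ico (n j : ℕ) : dyadicMid n (j % 2 ^ n) ∈ Set.Ico (0 : ℚ) 1 := by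
  have hlt : ((j % 2 ^ n : ℕ) : ℚ) + 1 ≤ 2 ^ n := by exact_mod_cast Nat.mod_lt j (by positivity)
  refine ⟨by unfold dyadicMid; positivity, ?_⟩
  rw [dyadicMid, div_lt_one (by positivity), pow_succ]
  linarith

lemma PartialComputable.partrecOn_cellData (hg : PartialComputable g) {D : Set (ℕ × ℕ)}
    (hD : ∀ n j, (n, j) ∈ D → (g (dyadicMid n (j % 2 ^ n))).Dom) : PartrecOn D (cellData g) := by
  obtain ⟨φ, hφ, hφg⟩ := hg
  have hquery : Primrec₂ fun n j : ℕ => ratCode (dyadicMid n (j % 2 ^ n)) :=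
    primrec₂_ratCode_dyadicMid.comp Primrec.fst
      (Primrec.nat_mod.comp Primrec.snd (primrec_two_pow.comp Primrec.fst))
  have hround : Primrec₂ fun (p : ℕ × ℕ) k => floorCode p.1 k :=
    primrec₂_floorCode.comp (Primrec.fst.comp Primrec.fst) Primrec.snd
  refine ⟨fun n j => (φ (ratCode (dyadicMid n (j % 2 ^ n)))).map (floorCode n),
    ((Partrec.nat_iff.2 hφ).comp hquery.to_comp).map hround.to_comp, fun n j hj => ?_⟩
  have hr := Part.get_mem (hD n j hj)
  rw [cellData_eq_floor hr, ← floorCode_ratCode]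
  refine Part.mem_map _ ?_
  rw [hφg]
  exact Part.mem_map _ hr

lemma computableOn_interpolant (c : ℕ) (hg : PartialComputable g) {b : ℝ}
    (hdom : ∀ n j, (n, j + 1) ∈ gridBelow b → (g (dyadicMid n (j % 2 ^ n))).Dom) :
    ComputableOn (interpolant c g) (Set.Ico 0 b) :=
  (isDyadicScheme_gridApprox c _).computableOn_dyadicLimit
    (partrecOn_gridApprox c (hg.partrecOn_cellData hdom))

lemma dyadicMid_mem_leftCut (h : (n, j + 1) ∈ gridBelow β) : dyadicMid n j ∈ leftCut β := by
  refine ⟨by unfold dyadicMid; positivity, ?_⟩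
  rw [cast_dyadicMid, div_lt_iff₀' (by positivity)]
  have := mem_gridBelow.1 h
  push_cast at this
  linarith

namespace IsQTranslation

lemma le_one (hg : IsQTranslation g β α) : β ≤ 1 := by
  by_contra! h
  have hdom := hg.dom_of_mem_leftCut 1 ⟨zero_le_one, by exact_mod_cast h⟩
  exact (hg.mem_unit _ _ (Part.get_mem hdom)).1.2.false

lemma pos (hg : IsQTranslation g β α) (hβ : 0 < β) : 0 < α := by
  have h0 : (0 : ℚ) ∈ leftCut β := ⟨le_rfl, by exact_mod_cast hβ⟩
  have hr := Part.get_mem (hg.dom_of_mem_leftCut 0 h0)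
  exact (Rat.cast_nonneg.2 (hg.mem_unit _ _ hr).2.1).trans_lt (hg.lt_of_mem_leftCut 0 h0 _ hr)

lemma mod_two_pow_eq (hg : IsQTranslation g β α) (h : (n, j + 1) ∈ gridBelow β) :
    j % 2 ^ n = j := by
  have hlt : ((j + 1 : ℕ) : ℝ) < 2 ^ n :=
    (mem_gridBelow.1 h).trans_le (mul_le_of_le_one_right (by positivity) hg.le_one)
  exact Nat.mod_eq_of_lt (j.lt_succ_self.trans (by exact_mod_cast hlt))

lemma dom_dyadicMid (hg : IsQTranslation g β α) (h : (n, j + 1) ∈ gridBelow β) :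
    (g (dyadicMid n (j % 2 ^ n))).Dom := by
  rw [hg.mod_two_pow_eq h]
  exact hg.dom_of_mem_leftCut _ (dyadicMid_mem_leftCut h)

lemma exists_cellData_eq (hg : IsQTranslation g β α) (h : (n, j + 1) ∈ gridBelow β) :
    ∃ r ∈ g (dyadicMid n j), cellData g n j = ⌊2 ^ n * (r : ℝ)⌋₊ := by
  obtain ⟨r, hr⟩ := Part.dom_iff_mem.1 (hg.dom_dyadicMid h)
  exact ⟨r, hg.mod_two_pow_eq h ▸ hr, cellData_eq_floor hr⟩

lemma cellData_le (hg : IsQTranslation g β α) (n j : ℕ) (h : (n, j + 1) ∈ gridBelow β) :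
    (cellData g n j : ℝ) ≤ 2 ^ n * α := by
  obtain ⟨r, hr, hdata⟩ := hg.exists_cellData_eq h
  have hr0 : (0 : ℝ) ≤ r := Rat.cast_nonneg.2 (hg.mem_unit _ _ hr).2.1
  rw [hdata]
  refine (Nat.floor_le (by positivity)).trans ?_
  gcongr
  exact (hg.lt_of_mem_leftCut _ (dyadicMid_mem_leftCut h) r hr).le

lemma le_cellData (hg : IsQTranslation g β α)
    (hc : ∀ q ∈ leftCut β, ∀ r ∈ g q, α - (r : ℝ) ≤ c * (β - (q : ℝ))) (n j : ℕ)
    (h : (n, j + 1) ∈ gridBelow β) :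
    2 ^ n * (α - c * β) + c * (j + 1) - (c + 1) ≤ (cellData g n j : ℝ) := by
  obtain ⟨r, hr, hdata⟩ := hg.exists_cellData_eq h
  have hαr : 2 ^ n * (α - c * β) + c * (j + 1 / 2) ≤ 2 ^ n * (r : ℝ) := by
    have hslope := hc _ (dyadicMid_mem_leftCut h) r hr
    rw [cast_dyadicMid] at hslope
    calc 2 ^ n * (α - c * β) + c * (j + 1 / 2)
        = 2 ^ n * (α - c * (β - (j + 1 / 2) / 2 ^ n)) := by
          field_simp
          ring
      _ ≤ 2 ^ n * (r : ℝ) := by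
          gcongr
          linarith
  have hfloor := Nat.sub_one_lt_floor (2 ^ n * (r : ℝ))
  rw [hdata]
  linarith [c.cast_nonneg (α := ℝ)]

lemma computableOn_interpolant (hg : IsQTranslation g β α) (c : ℕ) :
    ComputableOn (interpolant c g) (Set.Ico 0 β) :=
  SolovayVariants.computableOn_interpolant c hg.partialComputable fun _ _ => hg.dom_dyadicMid

end IsQTranslation

lemma lipschitzWith_interpolant (c : ℕ) (g : ℚ →. ℚ) : LipschitzWith c (interpolant c g) :=
  (isDyadicScheme_gridApprox c _).lipschitzWith_dyadicLimit

lemma SolovayReducibleVia.exists_interpolant_mem_Icc (h : SolovayReducibleVia g α β)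
    (hβ : 0 < β) :
    ∃ c : ℕ, ∀ x ∈ Set.Ico 0 β, interpolant c g x ∈ Set.Icc (α - c * (β - x)) α := by
  obtain ⟨hg, c₀, hc₀⟩ := h
  obtain ⟨c, hc⟩ := exists_nat_ge (max c₀ (α / β))
  have hαβ : α - c * β ≤ 0 := sub_nonpos.2 ((div_le_iff₀ hβ).1 ((le_max_right _ _).trans hc))
  have hslope : ∀ q ∈ leftCut β, ∀ r ∈ g q, α - (r : ℝ) ≤ c * (β - (q : ℝ)) := fun q hq r hr =>
    (hc₀ q hq r hr).le.trans <|
      mul_le_mul_of_nonneg_right ((le_max_left _ _).trans hc) (sub_nonneg.2 hq.2.le)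
  refine ⟨c, fun x hx => ⟨?_, dyadicLimit_gridApprox_le (hg.pos hβ).le hg.cellData_le hx⟩⟩
  calc α - c * (β - x) = α - c * β + c * x := by ring
    _ ≤ interpolant c g x := le_dyadicLimit_gridApprox hαβ (hg.le_cellData hslope) hx

lemma tendsto_of_mem_Icc {f : ℝ → ℝ} {c : ℝ}
    (hf : ∀ x ∈ Set.Ico 0 β, f x ∈ Set.Icc (α - c * (β - x)) α) :
    Tendsto f (𝓝[Set.Ico 0 β] β) (𝓝 α) := by
  have hlow : Tendsto (fun x => α - c * (β - x)) (𝓝[Set.Ico 0 β] β) (𝓝 α) :=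
    tendsto_nhdsWithin_of_tendsto_nhds <|
      Continuous.tendsto' (by fun_prop) β α (by ring)
  exact tendsto_of_tendsto_of_tendsto_of_le_of_le' hlow tendsto_const_nhds
    (eventually_nhdsWithin_of_forall fun x hx => (hf x hx).1)
    (eventually_nhdsWithin_of_forall fun x hx => (hf x hx).2)

lemma isRTranslation_of_nonpos (hβ : β ≤ 0) : IsRTranslation (fun _ => 0) β α := by
  have hempty : Set.Ico 0 β = ∅ := Set.Ico_eq_empty hβ.not_gt
  refine ⟨⟨⟨.zero, ?_⟩, ?_⟩, ?_⟩ <;> simp [hempty, Set.MapsTo]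

lemma SolovayReducible.exists_isWeakRTranslation (h : SolovayReducible α β) :
    ∃ f : ℝ → ℝ, IsWeakRTranslation f β α ∧ (∃ K : ℝ≥0, LipschitzOnWith K f (Set.Ico 0 β)) ∧
      MonotoneOn f (Set.Ico 0 β) ∧ Set.MapsTo f (Set.Ico 0 β) (Set.Icc 0 α) := by
  rcases le_or_gt β 0 with hβ | hβ
  · have h0 := isRTranslation_of_nonpos (α := α) hβ
    exact ⟨_, h0.toIsWeakRTranslation, ⟨0, (LipschitzWith.const 0).lipschitzOnWith⟩,
      monotoneOn_const, h0.mapsTo.mono_right Set.Ico_subset_Icc_self⟩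
  · obtain ⟨g, hg⟩ := h
    obtain ⟨c, hc⟩ := hg.exists_interpolant_mem_Icc hβ
    have hscheme := isDyadicScheme_gridApprox c (cellData g)
    exact ⟨interpolant c g, ⟨hg.1.computableOn_interpolant c, tendsto_of_mem_Icc hc⟩,
      ⟨c, (lipschitzWith_interpolant c g).lipschitzOnWith⟩,
      hscheme.monotone_dyadicLimit.monotoneOn _,
      fun x hx => ⟨hscheme.dyadicLimit_nonneg x, (hc x hx).2⟩⟩

lemma TotalSolovayReducible.clLocalReducible (hβ : 0 < β) (h : TotalSolovayReducible α β) :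
    CLLocalReducible α β := by
  obtain ⟨g, hg, htot⟩ := h
  obtain ⟨c, hc⟩ := hg.exists_interpolant_mem_Icc hβ
  have hlip := lipschitzWith_interpolant c g
  have hcomp : ComputableOn (interpolant c g) (Set.Ico 0 (β + 2)) :=
    computableOn_interpolant c hg.1.partialComputable fun n j _ =>
      htot _ (dyadicMid_mod_mem_Ico n j)
  have hne : (𝓝[Set.Ico 0 β] β).NeBot := by
    rw [← mem_closure_iff_nhdsWithin_neBot, closure_Ico hβ.ne]
    exact Set.right_mem_Icc.2 hβ.le
  exact ⟨β + 1, lt_add_one β, interpolant c g,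
    hcomp.mono (Set.Icc_subset_Ico_right (by linarith)), ⟨c, hlip.lipschitzOnWith⟩,
    tendsto_nhds_unique hlip.continuous.continuousWithinAt (tendsto_of_mem_Icc hc)⟩

end Translation

end SolovayVariants

theorem theorem3p1 (α β : ℝ) :
    (SolovayVariants.SolovayReducible α β → SolovayVariants.CLOpenReducible α β) ∧
    (0 < β → SolovayVariants.TotalSolovayReducible α β →
      SolovayVariants.CLLocalReducible α β) ∧
    (¬ SolovayVariants.ComputableReal α → SolovayVariants.SolovayReducible α β →
      SolovayVariants.RealSolovayReducible α β) := by
  refine ⟨fun h => ?_, fun hβ h => h.clLocalReducible hβ, fun hα h => ?_⟩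
  · obtain ⟨f, hf, hlip, -, -⟩ := h.exists_isWeakRTranslation
    exact ⟨f, hf, hlip⟩
  · obtain ⟨f, hf, hlip, hmono, hmaps⟩ := h.exists_isWeakRTranslation
    have hlt : Set.MapsTo f (Set.Ico 0 β) (Set.Ico 0 α) := fun x hx => ⟨(hmaps hx).1,
      hf.computableOn.lt_of_not_computableReal hmono (fun y hy => (hmaps hy).2) hα hx⟩
    exact ⟨f, ⟨hf, hlt⟩, hlip⟩
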